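/- Let $\mathfrak{B}_3:\mathbb{R}^2\to\mathbb{R}^3$ be the Bour surface of value 3, $$\mathfrak{B}_3(u,v)=\Bigl(-\tfrac{u^4}{4}-\tfrac{v^4}{4}+\tfrac32u^2v^2+\tfrac{u^2}{2}-\tfrac{v^2}{2},\ -u^3v+uv^3-uv,\ \tfrac23u^3-2uv^2\Bigr).$$ For a parametrized surface $X:\mathbb{R}^2\to\mathbb{R}^3$, say that $f=0$ is the irreducible implicit equation of $X$ if $f\in\mathbb{R}[x,y,z]$ is irreducible, $f(X(u,v))=0$ for all $u,v\in\mathbb{R}$, and $f$ divides every $g\in\mathbb{R}[x,y,z]$ with $g(X(u,v))=0$ for all $u,v\in\mathbb{R}$; in that case $X$ is called algebraic of degree $\deg f$ ($f$ is unique up to a nonzero constant factor). Call $X$ a minimal surface over an open set $U\subseteq\mathbb{R}^2$ if $X$ is smooth on $U$, $X_u\times X_v\neq0$ at every point of $U$, and the mean curvature of $X$ vanishes identically on $U$. Then $\mathfrak{B}_3$ has an irreducible implicit equation $f=0$, with $$f=43046721z^{16}-859963392x^4z^6-764411904x^4y^2z^4-1719926784x^2y^2z^6+509607936x^2y^4z^4+R,$$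 where $\deg f=16$ and $R\in\mathbb{R}[x,y,z]$ has degree less than $16$ and consists of exactly $69$ further monomial terms, so that $f$ has exactly $5+69=74$ terms. Moreover $\mathfrak{B}_3$ is a minimal surface over $\mathbb{R}^2\setminus\{(0,0)\}$ (the origin is its branch point). Thus $\mathfrak{B}_3$ is an algebraic minimal surface of degree $16$. -/

import Mathlib

open scoped Matrix ContDiff

noncomputable section

/-- The partial derivative `∂X/∂u` of a parametrized surface `X(u, v)` in `ℝ³`. -/
def partialU (X : ℝ → ℝ → Fin 3 → ℝ) (u v : ℝ) : Fin 3 → ℝ :=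
  deriv (fun s => X s v) u

/-- The partial derivative `∂X/∂v` of a parametrized surface `X(u, v)` in `ℝ³`. -/
def partialV (X : ℝ → ℝ → Fin 3 → ℝ) (u v : ℝ) : Fin 3 → ℝ :=
  deriv (fun t => X u t) v

/-- The parameter point `(u, v)` is regular if `X_u × X_v ≠ 0` there. -/
def IsRegularPoint (X : ℝ → ℝ → Fin 3 → ℝ) (u v : ℝ) : Prop :=
  partialU X u v ⨯₃ partialV X u v ≠ 0

/-- The unit normal `(X_u × X_v) / |X_u × X_v|` (Euclidean length), meaningful at regular points. -/
def unitNormal (X : ℝ → ℝ → Fin 3 → ℝ) (u v : ℝ) : Fin 3 → ℝ :=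
  (Real.sqrt ((partialU X u v ⨯₃ partialV X u v) ⬝ᵥ (partialU X u v ⨯₃ partialV X u v)))⁻¹ •
    (partialU X u v ⨯₃ partialV X u v)

/-- The mean curvature `H = (E N - 2 F M + G L) / (2 (E G - F ^ 2))`, where `E, F, G` and
`L, M, N` are the coefficients of the first and of the second fundamental form of `X`. It is
meaningful at regular points. -/
def meanCurvature (X : ℝ → ℝ → Fin 3 → ℝ) (u v : ℝ) : ℝ :=
  let E := partialU X u v ⬝ᵥ partialU X u v
  let F := partialU X u v ⬝ᵥ partialV X u v
  let G := partialV X u v ⬝ᵥ partialV X u v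
  let L := partialU (partialU X) u v ⬝ᵥ unitNormal X u v
  let M := partialV (partialU X) u v ⬝ᵥ unitNormal X u v
  let N := partialV (partialV X) u v ⬝ᵥ unitNormal X u v
  (E * N - 2 * F * M + G * L) / (2 * (E * G - F ^ 2))

/-- `X` is a minimal surface over the parameter domain `U`: on the open set `U` it is a smooth
regular surface whose mean curvature vanishes identically. -/
def IsMinimalSurfaceOn (X : ℝ → ℝ → Fin 3 → ℝ) (U : Set (ℝ × ℝ)) : Prop :=
  IsOpen U ∧ ContDiffOn ℝ ∞ (fun p : ℝ × ℝ => X p.1 p.2) U ∧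
    ∀ p ∈ U, IsRegularPoint X p.1 p.2 ∧ meanCurvature X p.1 p.2 = 0

/-- `f = 0` is the irreducible implicit equation of the parametrized surface `X`: the polynomial
`f(x, y, z)` is irreducible, it vanishes on `X`, and it divides every polynomial that vanishes
on `X` (so that it generates the ideal obtained by eliminating `u, v`). -/
def IsImplicitEquation (X : ℝ → ℝ → Fin 3 → ℝ) (f : MvPolynomial (Fin 3) ℝ) : Prop :=
  Irreducible f ∧
    (∀ u v : ℝ, MvPolynomial.eval (X u v) f = 0) ∧
    ∀ g : MvPolynomial (Fin 3) ℝ, (∀ u v : ℝ, MvPolynomial.eval (X u v) g = 0) → f ∣ g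

/-- The parametrized surface `X` is algebraic of degree `n`: its irreducible implicit equation
exists and has degree `n`. -/
def IsAlgebraicOfDegree (X : ℝ → ℝ → Fin 3 → ℝ) (n : ℕ) : Prop :=
  ∃ f : MvPolynomial (Fin 3) ℝ, IsImplicitEquation X f ∧ f.totalDegree = n

/-- The Bour surface of value `3`. -/
def bourSurface3 (u v : ℝ) : Fin 3 → ℝ :=
  ![-(u ^ 4 / 4) - v ^ 4 / 4 + 3 / 2 * u ^ 2 * v ^ 2 + u ^ 2 / 2 - v ^ 2 / 2,
    -(u ^ 3 * v) + u * v ^ 3 - u * v,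
    2 / 3 * u ^ 3 - 2 * u * v ^ 2]

/-- The five explicit terms of the implicit equation of the Bour surface of value `3`; the
variables `X 0, X 1, X 2` stand for `x, y, z`. -/
def bourExplicitTerms : MvPolynomial (Fin 3) ℝ :=
  let x : MvPolynomial (Fin 3) ℝ := MvPolynomial.X 0
  let y : MvPolynomial (Fin 3) ℝ := MvPolynomial.X 1
  let z : MvPolynomial (Fin 3) ℝ := MvPolynomial.X 2
  43046721 * z ^ 16 - 859963392 * x ^ 4 * z ^ 6 - 764411904 * x ^ 4 * y ^ 2 * z ^ 4
    - 1719926784 * x ^ 2 * y ^ 2 * z ^ 6 + 509607936 * x ^ 2 * y ^ 4 * z ^ 4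

end

open MvPolynomial

noncomputable section

/-! Minimality: the parametrization is isothermal and harmonic, so the mean curvature vanishes.

Implicit equation: `bourEquation` vanishes on the surface, and its leading monomial is the pure
power `z ^ 16`. Dividing any `g` that vanishes on the surface by it leaves a remainder `r` of
`z`-degree below 16 that also vanishes there. The top component of `r` for the weights 4, 4, 3
vanishes on the leading part of the parametrization. In coordinates `a, b` proportional to `u ± i
v`, that part has `x, y` depending only on `a ^ 4, b ^ 4`, and `z = (a ^ 3 + b ^ 3) / 3`.
Multiplying `a` and `b` by fourth roots of unity gives 16 values of `z` over one generic `(x, y)`,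
too many for `z`-degree below 16 (`eq_zero_of_aeval_bourRescaled_eq_zero`). Hence `r = 0` and
`bourEquation` generates the vanishing ideal. That ideal is prime, which yields irreducibility. -/

/-! ### Differential geometry: regularity and mean curvature. -/

lemma deriv_vec3 {f g h : ℝ → ℝ} {f' g' h' x : ℝ} (hf : HasDerivAt f f' x)
    (hg : HasDerivAt g g' x) (hh : HasDerivAt h h' x) :
    deriv (fun s => ![f s, g s, h s]) x = ![f', g', h'] := by
  refine HasDerivAt.deriv (hasDerivAt_pi.mpr fun i => ?_)
  fin_cases i
  · exact hf
  · exact hg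
  · exact hh

lemma partialU_bourSurface3 : partialU bourSurface3 = fun u v =>
    ![-u ^ 3 + 3 * u * v ^ 2 + u, -(3 * u ^ 2 * v) + v ^ 3 - v, 2 * u ^ 2 - 2 * v ^ 2] := by
  funext u v
  have h : ∀ n : ℕ, HasDerivAt (fun s : ℝ => s ^ n) (n * u ^ (n - 1)) u := fun n =>
    hasDerivAt_pow n u
  have h1 : HasDerivAt (fun s : ℝ => s) 1 u := hasDerivAt_id u
  refine deriv_vec3 ?_ ?_ ?_
  · have e := (((((h 4).div_const 4).neg.sub_const (v ^ 4 / 4)).add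
      (((h 2).const_mul (3 / 2)).mul_const (v ^ 2))).add ((h 2).div_const 2)).sub_const
        (v ^ 2 / 2)
    exact e.congr_deriv (by push_cast; ring)
  · have e := ((((h 3).mul_const v).neg).add (h1.mul_const (v ^ 3))).sub (h1.mul_const v)
    exact e.congr_deriv (by push_cast; ring)
  · have e := ((h 3).const_mul (2 / 3)).sub ((h1.const_mul 2).mul_const (v ^ 2))
    exact e.congr_deriv (by push_cast; ring)

lemma partialV_bourSurface3 : partialV bourSurface3 = fun u v =>
    ![-v ^ 3 + 3 * u ^ 2 * v - v, -u ^ 3 + 3 * u * v ^ 2 - u, -(4 * u * v)] := by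
  funext u v
  have h : ∀ n : ℕ, HasDerivAt (fun s : ℝ => s ^ n) (n * v ^ (n - 1)) v := fun n =>
    hasDerivAt_pow n v
  have h1 : HasDerivAt (fun s : ℝ => s) 1 v := hasDerivAt_id v
  refine deriv_vec3 ?_ ?_ ?_
  · have e := (((((h 4).div_const 4).const_sub (-(u ^ 4 / 4))).add
      ((h 2).const_mul (3 / 2 * u ^ 2))).add_const (u ^ 2 / 2)).sub ((h 2).div_const 2)
    exact e.congr_deriv (by push_cast; ring)
  · have e := (((h1.const_mul (u ^ 3)).neg).add ((h 3).const_mul u)).sub (h1.const_mul u)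
    exact e.congr_deriv (by push_cast; ring)
  · have e := ((h 2).const_mul (2 * u)).const_sub (2 / 3 * u ^ 3)
    exact e.congr_deriv (by push_cast; ring)

lemma partialU_partialU_bourSurface3 (u v : ℝ) : partialU (partialU bourSurface3) u v =
    ![-(3 * u ^ 2) + 3 * v ^ 2 + 1, -(6 * u * v), 4 * u] := by
  rw [partialU_bourSurface3]
  have h : ∀ n : ℕ, HasDerivAt (fun s : ℝ => s ^ n) (n * u ^ (n - 1)) u := fun n =>
    hasDerivAt_pow n u
  have h1 : HasDerivAt (fun s : ℝ => s) 1 u := hasDerivAt_id u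
  refine deriv_vec3 ?_ ?_ ?_
  · have e := ((h 3).neg.add ((h1.const_mul 3).mul_const (v ^ 2))).add h1
    exact e.congr_deriv (by push_cast; ring)
  · have e := ((((h 2).const_mul 3).mul_const v).neg.add_const (v ^ 3)).sub_const v
    exact e.congr_deriv (by push_cast; ring)
  · have e := ((h 2).const_mul 2).sub_const (2 * v ^ 2)
    exact e.congr_deriv (by push_cast; ring)

lemma partialV_partialV_bourSurface3 (u v : ℝ) : partialV (partialV bourSurface3) u v =
    ![-(3 * v ^ 2) + 3 * u ^ 2 - 1, 6 * u * v, -(4 * u)] := by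
  rw [partialV_bourSurface3]
  have h : ∀ n : ℕ, HasDerivAt (fun s : ℝ => s ^ n) (n * v ^ (n - 1)) v := fun n =>
    hasDerivAt_pow n v
  have h1 : HasDerivAt (fun s : ℝ => s) 1 v := hasDerivAt_id v
  refine deriv_vec3 ?_ ?_ ?_
  · have e := ((h 3).neg.add (h1.const_mul (3 * u ^ 2))).sub h1
    exact e.congr_deriv (by push_cast; ring)
  · have e := (((h 2).const_mul (3 * u)).const_add (-u ^ 3)).sub_const u
    exact e.congr_deriv (by push_cast; ring)
  · have e := (h1.const_mul (4 * u)).neg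
    exact e.congr_deriv (by ring)

lemma isRegularPoint_bourSurface3 {u v : ℝ} (h : (u, v) ≠ ((0 : ℝ), (0 : ℝ))) :
    IsRegularPoint bourSurface3 u v := by
  intro h0
  have hpos : 0 < u ^ 2 + v ^ 2 := by
    by_contra! hle
    apply h
    have hu : u ^ 2 = 0 := by nlinarith [sq_nonneg u, sq_nonneg v]
    have hv : v ^ 2 = 0 := by nlinarith [sq_nonneg u, sq_nonneg v]
    rw [pow_eq_zero_iff (by norm_num)] at hu hv
    rw [hu, hv]
  have hnorm := congrArg (fun w : Fin 3 → ℝ => w 0 ^ 2 + w 1 ^ 2 + w 2 ^ 2) h0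
  simp only [partialU_bourSurface3, partialV_bourSurface3, cross_apply, Matrix.cons_val,
    Pi.zero_apply] at hnorm
  -- The squared length of the normal is `E * G - F ^ 2 = E ^ 2`, with `E = (u ^ 2 + v ^ 2) * (1 + u
  -- ^ 2 + v ^ 2) ^ 2`.
  have hprod : ((u ^ 2 + v ^ 2) * (1 + (u ^ 2 + v ^ 2)) ^ 2) ^ 2 = 0 := by
    linear_combination hnorm
  have : 0 < ((u ^ 2 + v ^ 2) * (1 + (u ^ 2 + v ^ 2)) ^ 2) ^ 2 := by positivity
  exact this.ne' hprod

/-- With `E = G`, `F = 0` and `X_vv = -X_uu`, the numerator cancels whatever the normal is; this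
covers the branch point too. -/
lemma meanCurvature_bourSurface3 (u v : ℝ) : meanCurvature bourSurface3 u v = 0 := by
  have hEG : partialU bourSurface3 u v ⬝ᵥ partialU bourSurface3 u v =
      partialV bourSurface3 u v ⬝ᵥ partialV bourSurface3 u v := by
    simp only [partialU_bourSurface3, partialV_bourSurface3, Matrix.vec3_dotProduct']
    ring
  have hF : partialU bourSurface3 u v ⬝ᵥ partialV bourSurface3 u v = 0 := by
    simp only [partialU_bourSurface3, partialV_bourSurface3, Matrix.vec3_dotProduct']
    ring
  have hharm : partialV (partialV bourSurface3) u v = -partialU (partialU bourSurface3) u v := by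
    rw [partialU_partialU_bourSurface3, partialV_partialV_bourSurface3]
    ext i
    fin_cases i
    · simp
      ring
    · simp
    · simp
  simp only [meanCurvature, hEG, hF, hharm, neg_dotProduct]
  simp

lemma isMinimalSurfaceOn_bourSurface3 :
    IsMinimalSurfaceOn bourSurface3 {p | p ≠ (0, 0)} := by
  refine ⟨isOpen_ne, ContDiff.contDiffOn (contDiff_pi.mpr fun i => ?_), fun p hp =>
    ⟨isRegularPoint_bourSurface3 hp, meanCurvature_bourSurface3 p.1 p.2⟩⟩
  fin_cases i <;> simp only [bourSurface3] <;> simp <;> fun_prop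

/-! ### Polynomials given by lists of terms. -/

/-- The exponent vector of the monomial `x ^ i * y ^ j * z ^ k`. -/
def tripleExponent (e : ℕ × ℕ × ℕ) : Fin 3 →₀ ℕ :=
  Finsupp.equivFunOnFinite.symm ![e.1, e.2.1, e.2.2]

@[simp]
lemma tripleExponent_zero (e : ℕ × ℕ × ℕ) : tripleExponent e 0 = e.1 := rfl

@[simp]
lemma tripleExponent_one (e : ℕ × ℕ × ℕ) : tripleExponent e 1 = e.2.1 := rfl

@[simp]
lemma tripleExponent_two (e : ℕ × ℕ × ℕ) : tripleExponent e 2 = e.2.2 := rfl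

lemma tripleExponent_injective : Function.Injective tripleExponent := by
  rintro ⟨a, b, c⟩ ⟨a', b', c'⟩ h
  have h0 := DFunLike.congr_fun h 0
  have h1 := DFunLike.congr_fun h 1
  have h2 := DFunLike.congr_fun h 2
  simp only [tripleExponent_zero, tripleExponent_one, tripleExponent_two] at h0 h1 h2
  rw [h0, h1, h2]

lemma sum_tripleExponent (e : ℕ × ℕ × ℕ) :
    ((tripleExponent e).sum fun _ n => n) = e.1 + e.2.1 + e.2.2 := by
  rw [Finsupp.sum_fintype _ _ (fun _ => rfl), Fin.sum_univ_three]
  rfl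

/-- The real polynomial in three variables with a given list of integral terms. -/
def polyOfTerms (l : List ((ℕ × ℕ × ℕ) × ℤ)) : MvPolynomial (Fin 3) ℝ :=
  (l.map fun t => monomial (tripleExponent t.1) (t.2 : ℝ)).sum

lemma polyOfTerms_cons (t : (ℕ × ℕ × ℕ) × ℤ) (l : List ((ℕ × ℕ × ℕ) × ℤ)) :
    polyOfTerms (t :: l) = monomial (tripleExponent t.1) (t.2 : ℝ) + polyOfTerms l := by
  simp [polyOfTerms]

lemma polyOfTerms_append (l l' : List ((ℕ × ℕ × ℕ) × ℤ)) :
    polyOfTerms (l ++ l') = polyOfTerms l + polyOfTerms l' := by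
  simp [polyOfTerms]

lemma support_polyOfTerms (l : List ((ℕ × ℕ × ℕ) × ℤ)) (hl : (l.map Prod.fst).Nodup)
    (h0 : ∀ t ∈ l, t.2 ≠ 0) :
    (polyOfTerms l).support = (l.map Prod.fst).toFinset.image tripleExponent := by
  induction l with
  | nil => simp [polyOfTerms]
  | cons t l ih =>
    rw [List.map_cons, List.nodup_cons] at hl
    have ih := ih hl.2 fun s hs => h0 s (List.mem_cons_of_mem _ hs)
    have ht : (monomial (tripleExponent t.1) (t.2 : ℝ)).support = {tripleExponent t.1} := by
      rw [support_monomial, if_neg]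
      exact_mod_cast h0 t List.mem_cons_self
    have hd : Disjoint (monomial (tripleExponent t.1) (t.2 : ℝ)).support
        (polyOfTerms l).support := by
      rw [ht, ih, Finset.disjoint_singleton_left, Finset.mem_image]
      rintro ⟨e, he, hte⟩
      rw [tripleExponent_injective hte, List.mem_toFinset] at he
      exact hl.1 he
    have hs : (polyOfTerms (t :: l)).support =
        (monomial (tripleExponent t.1) (t.2 : ℝ)).support ∪ (polyOfTerms l).support := by
      rw [polyOfTerms_cons]
      exact Finsupp.support_add_eq hd
    rw [hs, ht, ih, List.map_cons, List.toFinset_cons, Finset.image_insert, Finset.insert_eq]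

lemma card_support_polyOfTerms (l : List ((ℕ × ℕ × ℕ) × ℤ)) (hl : (l.map Prod.fst).Nodup)
    (h0 : ∀ t ∈ l, t.2 ≠ 0) : (polyOfTerms l).support.card = l.length := by
  rw [support_polyOfTerms l hl h0, Finset.card_image_of_injective _ tripleExponent_injective,
    List.toFinset_card_of_nodup hl, List.length_map]

lemma eval_polyOfTerms (l : List ((ℕ × ℕ × ℕ) × ℤ)) (p : Fin 3 → ℝ) :
    eval p (polyOfTerms l) =
      (l.map fun t => (t.2 : ℝ) * (p 0 ^ t.1.1 * p 1 ^ t.1.2.1 * p 2 ^ t.1.2.2)).sum := by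
  induction l with
  | nil => simp [polyOfTerms]
  | cons t l ih =>
    rw [polyOfTerms_cons, map_add, ih, List.map_cons, List.sum_cons, eval_monomial,
      Finsupp.prod_fintype _ _ (fun _ => pow_zero _), Fin.prod_univ_three]
    rfl

/-! ### The equation: term count, degree and division by it. -/

/-- The terms of the implicit equation that the theorem displays. -/
def bourLeadingTerms : List ((ℕ × ℕ × ℕ) × ℤ) :=
  [((0, 0, 16), 43046721),
    ((4, 0, 6), -859963392),
    ((4, 2, 4), -764411904),
    ((2, 2, 6), -1719926784),
    ((2, 4, 4), 509607936)]

/-- The remaining terms of the implicit equation of the Bour surface of value `3`. -/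
def bourRemainingTerms : List ((ℕ × ℕ × ℕ) × ℤ) :=
  [((3, 0, 12), 272097792),
    ((1, 2, 12), -816293376),
    ((0, 0, 14), -459165024),
    ((2, 0, 12), -3877393536),
    ((0, 2, 12), -3877393536),
    ((4, 0, 10), -7255941120),
    ((2, 2, 10), -14511882240),
    ((0, 4, 10), -7255941120),
    ((6, 0, 8), -3009871872),
    ((4, 2, 8), -14834368512),
    ((2, 4, 8), -5159780352),
    ((0, 6, 8), -3654844416),
    ((3, 0, 10), 10037385216),
    ((1, 2, 10), -30112155648),
    ((5, 0, 8), 29023764480),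
    ((3, 2, 8), -58047528960),
    ((1, 4, 8), -87071293440),
    ((7, 0, 6), 22932357120),
    ((5, 2, 6), -22932357120),
    ((3, 4, 6), -114661785600),
    ((1, 6, 6), -68797071360),
    ((9, 0, 4), 5435817984),
    ((7, 2, 4), -6115295232),
    ((5, 4, 4), -10192158720),
    ((3, 6, 4), -56396611584),
    ((1, 8, 4), -14269022208),
    ((0, 0, 12), 1632586752),
    ((2, 0, 10), 14511882240),
    ((0, 2, 10), 14511882240),
    ((4, 0, 8), 37650272256),
    ((2, 2, 8), 75300544512),
    ((0, 4, 8), 37650272256),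
    ((6, 0, 6), 31340888064),
    ((4, 2, 6), 162819735552),
    ((2, 4, 6), 48157949952),
    ((0, 6, 6), 38985007104),
    ((8, 0, 4), 8153726976),
    ((6, 2, 4), 119757864960),
    ((4, 4, 4), 77970014208),
    ((2, 6, 4), -15797846016),
    ((0, 8, 4), 17836277760),
    ((8, 2, 2), 32614907904),
    ((6, 4, 2), 43486543872),
    ((4, 6, 2), -7247757312),
    ((2, 8, 2), -14495514624),
    ((0, 10, 2), 3623878656),
    ((8, 4, 0), 21743271936),
    ((6, 6, 0), -28991029248),
    ((4, 8, 0), 14495514624),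
    ((2, 10, 0), -3221225472),
    ((0, 12, 0), 268435456),
    ((3, 0, 8), 7309688832),
    ((1, 2, 8), -21929066496),
    ((5, 0, 6), 9459597312),
    ((3, 2, 6), -18919194624),
    ((1, 4, 6), -28378791936),
    ((7, 0, 4), 3057647616),
    ((5, 2, 4), -3057647616),
    ((3, 4, 4), -15288238080),
    ((1, 6, 4), -9172942848),
    ((7, 2, 2), 2717908992),
    ((5, 4, 2), -9965666304),
    ((3, 6, 2), 5737807872),
    ((1, 8, 2), -905969664),
    ((0, 0, 10), -1934917632),
    ((2, 0, 8), -2579890176),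
    ((0, 2, 8), -2579890176),
    ((0, 4, 6), -859963392),
    ((0, 6, 4), -84934656)]

/-- The implicit equation of the Bour surface of value `3`. -/
def bourEquation : MvPolynomial (Fin 3) ℝ :=
  polyOfTerms (bourLeadingTerms ++ bourRemainingTerms)

lemma polyOfTerms_bourLeadingTerms : polyOfTerms bourLeadingTerms = bourExplicitTerms := by
  have hm (e : ℕ × ℕ × ℕ) (c : ℝ) : monomial (tripleExponent e) c =
      C c * (X 0 ^ e.1 * X 1 ^ e.2.1 * X 2 ^ e.2.2) := by
    rw [monomial_eq, Finsupp.prod_fintype _ _ (fun _ => pow_zero _), Fin.prod_univ_three]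
    rfl
  simp only [polyOfTerms, bourLeadingTerms, bourExplicitTerms, List.map_cons, List.map_nil,
    List.sum_cons, List.sum_nil, hm]
  push_cast
  simp only [map_neg, map_ofNat]
  ring

lemma bourEquation_eq :
    bourEquation = bourExplicitTerms + polyOfTerms bourRemainingTerms := by
  rw [bourEquation, polyOfTerms_append, polyOfTerms_bourLeadingTerms]

lemma nodup_bourTerms : ((bourLeadingTerms ++ bourRemainingTerms).map Prod.fst).Nodup := by
  decide +kernel

lemma bourTerms_ne_zero : ∀ t ∈ bourLeadingTerms ++ bourRemainingTerms, t.2 ≠ 0 := by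
  decide +kernel

lemma card_support_bourEquation : bourEquation.support.card = 5 + 69 :=
  card_support_polyOfTerms _ nodup_bourTerms bourTerms_ne_zero

lemma nodup_bourRemainingTerms : (bourRemainingTerms.map Prod.fst).Nodup := by
  have h := nodup_bourTerms
  rw [List.map_append] at h
  exact h.of_append_right

lemma bourRemainingTerms_ne_zero : ∀ t ∈ bourRemainingTerms, t.2 ≠ 0 :=
  fun t ht => bourTerms_ne_zero t (List.mem_append_right _ ht)

lemma card_support_remainder : (polyOfTerms bourRemainingTerms).support.card = 69 :=
  card_support_polyOfTerms _ nodup_bourRemainingTerms bourRemainingTerms_ne_zero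

lemma totalDegree_remainder_lt : (polyOfTerms bourRemainingTerms).totalDegree < 16 := by
  rw [totalDegree, Finset.sup_lt_iff (by norm_num),
    support_polyOfTerms _ nodup_bourRemainingTerms bourRemainingTerms_ne_zero]
  intro d hd
  obtain ⟨e, he, rfl⟩ := Finset.mem_image.mp hd
  rw [sum_tripleExponent]
  have h : ∀ e ∈ bourRemainingTerms.map Prod.fst, e.1 + e.2.1 + e.2.2 < 16 := by decide +kernel
  exact h e (List.mem_toFinset.mp he)

lemma support_bourEquation : bourEquation.support =
    ((bourLeadingTerms ++ bourRemainingTerms).map Prod.fst).toFinset.image tripleExponent :=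
  support_polyOfTerms _ nodup_bourTerms bourTerms_ne_zero

lemma totalDegree_bourEquation : bourEquation.totalDegree = 16 := by
  rw [totalDegree, support_bourEquation]
  apply le_antisymm
  · refine Finset.sup_le fun d hd => ?_
    obtain ⟨e, he, rfl⟩ := Finset.mem_image.mp hd
    rw [sum_tripleExponent]
    have h : ∀ e ∈ (bourLeadingTerms ++ bourRemainingTerms).map Prod.fst,
        e.1 + e.2.1 + e.2.2 ≤ 16 := by decide +kernel
    exact h e (List.mem_toFinset.mp he)
  · refine le_trans ?_ (Finset.le_sup (Finset.mem_image_of_mem tripleExponent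
      (List.mem_toFinset.mpr (?_ : (0, 0, 16) ∈ _))))
    · exact (sum_tripleExponent (0, 0, 16)).ge
    · decide +kernel

lemma bourEquation_ne_zero : bourEquation ≠ 0 := by
  intro h
  have h' := totalDegree_bourEquation
  rw [h, totalDegree_zero] at h'
  norm_num at h'

/-- Only one term has total degree 16, so a graded order must select it. -/
lemma degree_degLex_bourEquation :
    MonomialOrder.degLex.degree bourEquation = tripleExponent (0, 0, 16) := by
  have hmem := MonomialOrder.degree_mem_support (m := MonomialOrder.degLex) bourEquation_ne_zero
  have hdeg := degree_degLexDegree (f := bourEquation)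
  rw [totalDegree_bourEquation] at hdeg
  rw [support_bourEquation, Finset.mem_image] at hmem
  obtain ⟨e, he, hed⟩ := hmem
  rw [← hed] at hdeg ⊢
  have hsum : e.1 + e.2.1 + e.2.2 = 16 := by
    rw [← sum_tripleExponent, ← hdeg]
    rfl
  have h : ∀ e ∈ (bourLeadingTerms ++ bourRemainingTerms).map Prod.fst,
      e.1 + e.2.1 + e.2.2 = 16 → e = (0, 0, 16) := by decide +kernel
  rw [h e (List.mem_toFinset.mp he) hsum]

/-- No monomial of the remainder is divisible by the leading monomial `z ^ 16`. -/
lemma exists_eq_mul_bourEquation_add (g : MvPolynomial (Fin 3) ℝ) :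
    ∃ q r : MvPolynomial (Fin 3) ℝ, g = q * bourEquation + r ∧ ∀ d ∈ r.support, d 2 < 16 := by
  have hu : IsUnit (MonomialOrder.degLex.leadingCoeff bourEquation) :=
    (MonomialOrder.leadingCoeff_ne_zero_iff.mpr bourEquation_ne_zero).isUnit
  obtain ⟨q, r, h, -, hr⟩ := MonomialOrder.div_single hu g
  refine ⟨q, r, h, fun d hd => ?_⟩
  by_contra! h16
  apply hr d hd
  rw [degree_degLex_bourEquation]
  intro i
  fin_cases i
  · simp
  · simp
  · exact h16

/-! ### Vanishing of the equation on the surface. -/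

/-- The implicit equation of the Bour surface in terms of the generators `m = x ^ 2 + y ^ 2`,
`n = 2 * (x ^ 3 - 3 * x * y ^ 2)`, `t = 9 * z ^ 2` of the invariants of its symmetry group. -/
def bourInvariantEquation (m n t : ℝ) : ℝ :=
  t ^ 8 - 96 * t ^ 7 + 3072 * t ^ 6 + 256 * n * t ^ 6 - 7296 * m * t ^ 6 - 32768 * t ^ 5 +
    84992 * n * t ^ 5 + 245760 * m * t ^ 5 - 122880 * m ^ 2 * t ^ 5 + 557056 * n * t ^ 4 +
    24576 * n ^ 2 * t ^ 4 - 393216 * m * t ^ 4 + 2211840 * m * n * t ^ 4 + 5738496 * m ^ 2 * t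
    ^ 4 - 557056 * m ^ 3 * t ^ 4 - 2621440 * n ^ 2 * t ^ 3 + 6488064 * m * n * t ^ 3 - 1179648
    * m ^ 2 * t ^ 3 + 15728640 * m ^ 2 * n * t ^ 3 + 53477376 * m ^ 3 * t ^ 3 + 262144 * n ^ 2
    * t ^ 2 + 1048576 * n ^ 3 * t ^ 2 - 29884416 * m * n ^ 2 * t ^ 2 + 18874368 * m ^ 2 * n *
    t ^ 2 - 1048576 * m ^ 3 * t ^ 2 + 29360128 * m ^ 3 * n * t ^ 2 + 220200960 * m ^ 4 * t ^ 2
    - 4194304 * n ^ 3 * t - 100663296 * m ^ 2 * n ^ 2 * t + 16777216 * m ^ 3 * n * t +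
    402653184 * m ^ 5 * t + 16777216 * n ^ 4 - 134217728 * m ^ 3 * n ^ 2 + 268435456 * m ^ 6

lemma eval_bourEquation (p : Fin 3 → ℝ) : eval p bourEquation =
    bourInvariantEquation (p 0 ^ 2 + p 1 ^ 2) (2 * (p 0 ^ 3 - 3 * p 0 * p 1 ^ 2))
      (9 * p 2 ^ 2) := by
  rw [bourEquation, eval_polyOfTerms]
  simp only [bourLeadingTerms, bourRemainingTerms, List.cons_append, List.nil_append,
    List.map_cons, List.map_nil, List.sum_cons, List.sum_nil, bourInvariantEquation]
  push_cast
  ring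

/-- With `c = |w| ^ 2` and `s = 2 * Re (w ^ 6)`, where `w = u + i v`, the arguments are the
invariants `m, n, t` of the surface point with parameters `u, v`. -/
lemma bourInvariantEquation_eq_zero (c s : ℝ) :
    bourInvariantEquation ((4 * c ^ 2 - 2 * s + c ^ 4) / 16)
      ((8 * s - 24 * c ^ 4 + 6 * c ^ 2 * s - s ^ 2 + 2 * c ^ 6) / 64) (s + 2 * c ^ 3) = 0 := by
  simp only [bourInvariantEquation]
  ring

lemma eval_bourSurface3_bourEquation (u v : ℝ) :
    eval (bourSurface3 u v) bourEquation = 0 := by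
  rw [eval_bourEquation, ← bourInvariantEquation_eq_zero (u ^ 2 + v ^ 2)
    (2 * (u ^ 6 - 15 * u ^ 4 * v ^ 2 + 15 * u ^ 2 * v ^ 4 - v ^ 6))]
  congr 1 <;> simp [bourSurface3] <;> ring

/-! ### Complexification and the weighted leading part. -/

/-- The polynomial parametrization of the Bour surface of value `3`. -/
def bourParam : Fin 3 → MvPolynomial (Fin 2) ℝ :=
  ![C (1 / 4) * (-X 0 ^ 4 - X 1 ^ 4 + 6 * X 0 ^ 2 * X 1 ^ 2 + 2 * X 0 ^ 2 - 2 * X 1 ^ 2),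
    -(X 0 ^ 3 * X 1) + X 0 * X 1 ^ 3 - X 0 * X 1,
    C (1 / 3) * (2 * X 0 ^ 3 - 6 * X 0 * X 1 ^ 2)]

lemma eval_bourParam (x : Fin 2 → ℝ) (i : Fin 3) :
    eval x (bourParam i) = bourSurface3 (x 0) (x 1) i := by
  fin_cases i <;> simp [bourParam, bourSurface3] <;> ring

lemma eval_bind₁_bourParam (g : MvPolynomial (Fin 3) ℝ) (x : Fin 2 → ℝ) :
    eval x (bind₁ bourParam g) = eval (bourSurface3 (x 0) (x 1)) g := by
  rw [← coe_aeval_eq_eval, RingHom.coe_coe, aeval_bind₁, ← RingHom.coe_coe, coe_aeval_eq_eval]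
  congr 2
  funext i
  rw [← eval_bourParam, ← coe_aeval_eq_eval, RingHom.coe_coe]

/-- Vanishing at all real parameters is a polynomial identity, hence persists at complex ones, where
`u + i v` and `u - i v` become independent. -/
lemma aeval_bourParam_eq_zero {g : MvPolynomial (Fin 3) ℝ}
    (hg : ∀ u v : ℝ, eval (bourSurface3 u v) g = 0) (x : Fin 2 → ℂ) :
    aeval (fun i => aeval x (bourParam i)) g = 0 := by
  have h : bind₁ bourParam g = 0 := by
    refine MvPolynomial.funext fun y => ?_
    rw [eval_bind₁_bourParam, hg, map_zero]
  rw [← aeval_bind₁, h, map_zero]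

/-- The weights of `x, y, z` given by the degrees of the parametrization. -/
def bourWeight : Fin 3 → ℕ := ![4, 4, 3]

/-- The parametrization in the isotropic coordinates `u + i v = a / s`, `u - i v = b / s`,
rescaled according to the weights; its value at `s = 0` is the leading part. -/
def bourRescaled (a b s : ℂ) : Fin 3 → ℂ :=
  ![(-(a ^ 4 + b ^ 4) + 2 * s ^ 2 * (a ^ 2 + b ^ 2)) / 8,
    Complex.I * (a ^ 4 - b ^ 4 + 2 * s ^ 2 * (a ^ 2 - b ^ 2)) / 8,
    (a ^ 3 + b ^ 3) / 3]

lemma bourRescaled_eq (a b s : ℂ) (hs : s ≠ 0) (i : Fin 3) :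
    bourRescaled a b s i = s ^ bourWeight i *
      aeval ![(a + b) / (2 * s), -Complex.I * (a - b) / (2 * s)] (bourParam i) := by
  have h2 : Complex.I ^ 2 = -1 := Complex.I_sq
  have h4 : Complex.I ^ 4 = 1 := Complex.I_pow_four
  fin_cases i <;> simp [bourRescaled, bourParam, bourWeight] <;> field_simp <;> ring_nf <;>
    simp only [h2, h4] <;> ring

lemma aeval_weightedHomogeneousComponent_eq_zero {g : MvPolynomial (Fin 3) ℝ}
    (hg : ∀ u v : ℝ, eval (bourSurface3 u v) g = 0) (a b : ℂ) :
    aeval (bourRescaled a b 0)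
      (weightedHomogeneousComponent bourWeight (weightedTotalDegree bourWeight g) g) = 0 := by
  set D := weightedTotalDegree bourWeight g
  -- For `s ≠ 0` this is `s ^ D` times the value of `g` on the surface, hence zero. By continuity it
  -- vanishes at `s = 0`, where only the terms of weight `D` survive.
  let h : ℂ → ℂ := fun s => ∑ d ∈ g.support, ((coeff d g : ℝ) : ℂ) *
    (s ^ (D - Finsupp.weight bourWeight d) * ∏ i, bourRescaled a b s i ^ d i)
  have hcont : Continuous h := by
    refine continuous_finsetSum _ fun d _ => continuous_const.mul ((continuous_pow _).mul
      (continuous_finsetProd _ fun i _ => Continuous.pow ?_ _))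
    fin_cases i <;> simp only [bourRescaled] <;> simp <;> fun_prop
  have hzero : ∀ s ≠ 0, h s = 0 := by
    intro s hs
    have := aeval_bourParam_eq_zero hg ![(a + b) / (2 * s), -Complex.I * (a - b) / (2 * s)]
    rw [aeval_def, eval₂_eq'] at this
    rw [← mul_zero (s ^ D), ← this, Finset.mul_sum]
    refine Finset.sum_congr rfl fun d hd => ?_
    have hle : Finsupp.weight bourWeight d ≤ D := le_weightedTotalDegree _ hd
    have hw : Finsupp.weight bourWeight d = ∑ i, bourWeight i * d i := by
      rw [Finsupp.weight_apply, Finsupp.sum_fintype _ _ (fun i => zero_nsmul (bourWeight i))]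
      simp [mul_comm]
    simp only [bourRescaled_eq a b s hs, mul_pow, Finset.prod_mul_distrib, ← pow_mul,
      Finset.prod_pow_eq_pow_sum, ← hw]
    rw [← Nat.sub_add_cancel hle, pow_add, Nat.add_sub_cancel]
    simp only [Complex.coe_algebraMap]
    ring
  have h0 : h 0 = 0 := by
    have hcl : IsClosed {s | h s = 0} := isClosed_eq hcont continuous_const
    have hsub : ({0}ᶜ : Set ℂ) ⊆ {s | h s = 0} := fun s hs => hzero s hs
    exact hcl.closure_subset_iff.mpr hsub ((dense_compl_singleton (0 : ℂ)) 0)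
  rw [weightedHomogeneousComponent_apply, map_sum, Finset.sum_filter]
  refine Eq.trans ?_ h0
  refine Finset.sum_congr rfl fun d hd => ?_
  have hle : Finsupp.weight bourWeight d ≤ D := le_weightedTotalDegree _ hd
  split_ifs with hdD
  · rw [aeval_monomial, Finsupp.prod_fintype _ _ (fun _ => pow_zero _), hdD]
    simp
  · rw [zero_pow (by omega)]
    simp

/-- Distinct fourth roots of unity lie at distance between `√2` and 2, so a change in the `B` term
is too large for the `A` term to compensate. -/
lemma injective_I_pow_mul_add {A B : ℝ} (hA : 0 < A) (hB : 2 * A < B) :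
    Function.Injective fun k : Fin 4 × Fin 4 =>
      Complex.I ^ (k.1 : ℕ) * A + Complex.I ^ (k.2 : ℕ) * B := by
  have hlower : ∀ k l : Fin 4, k ≠ l →
      2 ≤ Complex.normSq (Complex.I ^ (k : ℕ) - Complex.I ^ (l : ℕ)) := by
    intro k l hkl
    fin_cases k <;> fin_cases l <;>
      simp [Complex.normSq_apply, Complex.I_pow_three] at hkl ⊢ <;> norm_num
  have hupper : ∀ k l : Fin 4,
      Complex.normSq (Complex.I ^ (k : ℕ) - Complex.I ^ (l : ℕ)) ≤ 4 := by
    intro k l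
    fin_cases k <;> fin_cases l <;>
      simp [Complex.normSq_apply, Complex.I_pow_three] <;> norm_num
  rintro ⟨k, l⟩ ⟨k', l'⟩ h
  have hdiff : (Complex.I ^ (l : ℕ) - Complex.I ^ (l' : ℕ)) * B =
      (Complex.I ^ (k' : ℕ) - Complex.I ^ (k : ℕ)) * A := by
    linear_combination h
  have hnorm := congrArg Complex.normSq hdiff
  rw [map_mul, map_mul, Complex.normSq_ofReal, Complex.normSq_ofReal] at hnorm
  have hl : l = l' := by
    by_contra hne
    nlinarith [hlower l l' hne, hupper k' k, mul_pos hA hA]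
  subst hl
  have hk : k = k' := by
    by_contra hne
    rw [sub_self, map_zero, zero_mul] at hnorm
    nlinarith [hlower k' k (Ne.symm hne), mul_pos hA hA]
  rw [hk]

/-- A polynomial of degree less than `16` in `z` that vanishes on the leading part of the
parametrization is zero. -/
lemma eq_zero_of_aeval_bourRescaled_eq_zero {q : MvPolynomial (Fin 3) ℝ}
    (hdeg : ∀ d ∈ q.support, d 2 < 16)
    (hq : ∀ a b : ℂ, aeval (bourRescaled a b 0) q = 0) : q = 0 := by
  have hfiber : ∀ a b : ℝ, 0 < a → 2 * a ^ 3 < b ^ 3 → ∀ z : ℂ,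
      aeval ![-((a : ℂ) ^ 4 + b ^ 4) / 8, Complex.I * ((a : ℂ) ^ 4 - b ^ 4) / 8, z] q = 0 := by
    intro a b ha hab z
    let p : Polynomial ℂ := aeval ![Polynomial.C (-((a : ℂ) ^ 4 + b ^ 4) / 8),
      Polynomial.C (Complex.I * ((a : ℂ) ^ 4 - b ^ 4) / 8), Polynomial.X] q
    have heval : ∀ w : ℂ, p.eval w =
        aeval ![-((a : ℂ) ^ 4 + b ^ 4) / 8, Complex.I * ((a : ℂ) ^ 4 - b ^ 4) / 8, w] q := by
      intro w
      simp only [p, aeval_def, eval₂_eq', Fin.prod_univ_three]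
      simp [Polynomial.eval_finsetSum, Polynomial.algebraMap_apply]
    have hnat : p.natDegree < 16 := by
      refine lt_of_le_of_lt (Polynomial.natDegree_le_iff_coeff_eq_zero.mpr ?_)
        (by norm_num : 15 < 16)
      intro N hN
      simp only [p, aeval_def, eval₂_eq', Fin.prod_univ_three, Polynomial.finsetSum_coeff]
      refine Finset.sum_eq_zero fun d hd => ?_
      have hN' : N ≠ d 2 := by have := hdeg d hd; omega
      simp only [Matrix.cons_val, ← Polynomial.C_pow, ← Polynomial.C_mul,
        Polynomial.algebraMap_apply, ← mul_assoc, Polynomial.coeff_C_mul_X_pow, if_neg hN']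
    have hA : (0 : ℝ) < a ^ 3 := by positivity
    have hp : p = 0 := by
      refine Polynomial.eq_zero_of_natDegree_lt_card_of_eval_eq_zero p
        (f := fun k : Fin 4 × Fin 4 => (Complex.I ^ (k.1 : ℕ) * (a ^ 3 : ℝ) +
          Complex.I ^ (k.2 : ℕ) * (b ^ 3 : ℝ)) / 3) ?_ ?_ ?_
      · exact fun k l hkl => injective_I_pow_mul_add hA hab ((div_left_inj' three_ne_zero).mp hkl)
      · rintro ⟨k, l⟩
        -- The exponent `3 * k` is chosen because cubing then gives `I ^ (9 * k) = I ^ k`, while the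
        -- fourth power is unchanged.
        rw [heval, ← hq (Complex.I ^ (3 * (k : ℕ)) * a) (Complex.I ^ (3 * (l : ℕ)) * b)]
        have h4 : ∀ n : ℕ, Complex.I ^ (n * 4) = 1 := fun n => by
          rw [mul_comm, pow_mul, Complex.I_pow_four, one_pow]
        have h12 : ∀ n : ℕ, (Complex.I ^ (3 * n)) ^ 4 = 1 := fun n => by
          rw [← pow_mul, h4]
        have h9 : ∀ n : ℕ, (Complex.I ^ (3 * n)) ^ 3 = Complex.I ^ n := fun n => by
          rw [← pow_mul, show 3 * n * 3 = 2 * n * 4 + n by ring, pow_add, h4, one_mul]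
        congr 2
        simp [bourRescaled, mul_pow, h12, h9]
      · simpa using hnat
    rw [← heval, hp, Polynomial.eval_zero]
  have hmap : map (algebraMap ℝ ℂ) q = 0 := by
    -- A product of infinite sets suffices to kill a polynomial. With `x = r` and `y = I * t`,
    -- solving for `a, b` gives `a ^ 4 = 4 * (t - r)` in `(4, 12)` and `b ^ 4 = -4 * (t + r)` in
    -- `(80, 88)`, which forces `2 * a ^ 3 < b ^ 3`.
    let s : Fin 3 → Set ℂ := ![(fun r : ℝ => (r : ℂ)) '' Set.Ioo (-12) (-11),
      (fun r : ℝ => Complex.I * r) '' Set.Ioo (-10) (-9), Set.univ]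
    have hs : ∀ i, (s i).Infinite := by
      intro i
      fin_cases i
      · exact (Set.Ioo_infinite (by norm_num)).image Complex.ofReal_injective.injOn
      · refine (Set.Ioo_infinite (by norm_num)).image (Function.Injective.injOn ?_)
        exact (mul_right_injective₀ Complex.I_ne_zero).comp Complex.ofReal_injective
      · exact Set.infinite_univ
    refine funext_set s hs fun x hx => ?_
    obtain ⟨r, ⟨hr1, hr2⟩, hr⟩ := hx 0 trivial
    obtain ⟨t, ⟨ht1, ht2⟩, ht⟩ := hx 1 trivial
    rw [map_zero, eval_map, ← aeval_def]
    have ha4 : 0 < 4 * (t - r) := by linarith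
    have hb4 : 0 < -4 * (t + r) := by linarith
    let a := (4 * (t - r)) ^ (1 / 4 : ℝ)
    let b := (-4 * (t + r)) ^ (1 / 4 : ℝ)
    have ha : a ^ 4 = 4 * (t - r) := by
      rw [← Real.rpow_natCast, ← Real.rpow_mul ha4.le]
      norm_num
    have hb : b ^ 4 = -4 * (t + r) := by
      rw [← Real.rpow_natCast, ← Real.rpow_mul hb4.le]
      norm_num
    have hapos : 0 < a := Real.rpow_pos_of_pos ha4 _
    have hbpos : 0 < b := Real.rpow_pos_of_pos hb4 _
    have hab : 2 * a ^ 3 < b ^ 3 := by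
      refine lt_of_pow_lt_pow_left₀ 4 (by positivity) ?_
      calc (2 * a ^ 3) ^ 4 = 16 * (a ^ 4) ^ 3 := by ring
        _ ≤ 16 * 12 ^ 3 := by gcongr; linarith
        _ < 76 ^ 3 := by norm_num
        _ ≤ (b ^ 4) ^ 3 := by gcongr; linarith
        _ = (b ^ 3) ^ 4 := by ring
    rw [← hfiber a b hapos hab (x 2)]
    have haC : (a : ℂ) ^ 4 = 4 * (t - r) := by exact_mod_cast ha
    have hbC : (b : ℂ) ^ 4 = -4 * (t + r) := by exact_mod_cast hb
    congr 2
    funext i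
    fin_cases i
    · simp only [haC, hbC]
      simp only [Fin.zero_eta, Matrix.cons_val, ← hr]
      ring
    · simp only [haC, hbC]
      simp only [Fin.mk_one, Matrix.cons_val, ← ht]
      ring
    · simp
  exact map_injective _ (algebraMap ℝ ℂ).injective (hmap.trans (map_zero _).symm)

/-- The top weighted component of a nonzero `r` is nonzero, and its monomials are among those of
`r`, so the bound on the `z`-degree passes to it. -/
lemma eq_zero_of_eval_bourSurface3_eq_zero {r : MvPolynomial (Fin 3) ℝ}
    (hdeg : ∀ d ∈ r.support, d 2 < 16)
    (hr : ∀ u v : ℝ, eval (bourSurface3 u v) r = 0) : r = 0 := by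
  by_contra hne
  obtain ⟨d, hd, hdw⟩ := Finset.exists_mem_eq_sup r.support (support_nonempty.mpr hne)
    (Finsupp.weight bourWeight)
  set q := weightedHomogeneousComponent bourWeight (weightedTotalDegree bourWeight r) r
  have hcoeff : ∀ e, coeff e q =
      if Finsupp.weight bourWeight e = weightedTotalDegree bourWeight r then coeff e r else 0 :=
    fun e => coeff_weightedHomogeneousComponent _ _ e
  have hq0 : q = 0 := by
    refine eq_zero_of_aeval_bourRescaled_eq_zero (fun e he => hdeg e ?_)
      (aeval_weightedHomogeneousComponent_eq_zero hr)
    rw [mem_support_iff, hcoeff] at he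
    rw [mem_support_iff]
    exact fun h => he (by simp [h])
  have := hcoeff d
  rw [hq0, coeff_zero, if_pos (by exact hdw.symm)] at this
  exact mem_support_iff.mp hd this.symm

/-! ### Divisibility, primality and irreducibility. -/

/-- `bourEquation` divides every polynomial that vanishes on the surface. -/
lemma bourEquation_dvd {g : MvPolynomial (Fin 3) ℝ}
    (hg : ∀ u v : ℝ, eval (bourSurface3 u v) g = 0) : bourEquation ∣ g := by
  obtain ⟨q, r, rfl, hr⟩ := exists_eq_mul_bourEquation_add g
  have hr0 : r = 0 := eq_zero_of_eval_bourSurface3_eq_zero hr fun u v => by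
    have h := hg u v
    rwa [map_add, map_mul, eval_bourSurface3_bourEquation, mul_zero, zero_add] at h
  rw [hr0, add_zero]
  exact dvd_mul_left _ _

/-- The polynomials that vanish on the surface form a prime ideal. -/
lemma eval_bourSurface3_eq_zero_or_eq_zero {g h : MvPolynomial (Fin 3) ℝ}
    (hgh : ∀ u v : ℝ, eval (bourSurface3 u v) (g * h) = 0) :
    (∀ u v : ℝ, eval (bourSurface3 u v) g = 0) ∨ ∀ u v : ℝ, eval (bourSurface3 u v) h = 0 := by
  -- The vanishing ideal is the kernel of a ring homomorphism into the domain `ℝ[u, v]`.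
  have hmul : bind₁ bourParam g * bind₁ bourParam h = 0 := by
    refine MvPolynomial.funext fun x => ?_
    rw [← map_mul, eval_bind₁_bourParam, hgh, map_zero]
  have hvanish {k : MvPolynomial (Fin 3) ℝ} (hk : bind₁ bourParam k = 0) (u v : ℝ) :
      eval (bourSurface3 u v) k = 0 := by
    have := eval_bind₁_bourParam k ![u, v]
    rw [hk, map_zero] at this
    exact this.symm
  exact (mul_eq_zero.mp hmul).imp hvanish hvanish

lemma irreducible_bourEquation : Irreducible bourEquation := by
  have hprime : Prime bourEquation := by
    refine ⟨bourEquation_ne_zero, fun hu => ?_, fun g h hgh => ?_⟩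
    · exact (hu.map (eval (bourSurface3 0 0))).ne_zero (eval_bourSurface3_bourEquation 0 0)
    · refine (eval_bourSurface3_eq_zero_or_eq_zero fun u v => ?_).imp bourEquation_dvd
        bourEquation_dvd
      obtain ⟨k, hk⟩ := hgh
      rw [hk, map_mul, eval_bourSurface3_bourEquation, zero_mul]
  exact hprime.irreducible

lemma isImplicitEquation_bourEquation : IsImplicitEquation bourSurface3 bourEquation :=
  ⟨irreducible_bourEquation, eval_bourSurface3_bourEquation, fun _ => bourEquation_dvd⟩

end

theorem mainTheorem1 :
    (∃ f R : MvPolynomial (Fin 3) ℝ,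
      IsImplicitEquation bourSurface3 f ∧
      f.totalDegree = 16 ∧
      f = bourExplicitTerms + R ∧
      R.totalDegree < 16 ∧
      R.support.card = 69 ∧
      f.support.card = 5 + 69) ∧
    IsMinimalSurfaceOn bourSurface3 {p | p ≠ (0, 0)} ∧
    IsAlgebraicOfDegree bourSurface3 16 :=
  ⟨⟨bourEquation, polyOfTerms bourRemainingTerms, isImplicitEquation_bourEquation,
    totalDegree_bourEquation, bourEquation_eq, totalDegree_remainder_lt,
    card_support_remainder, card_support_bourEquation⟩,
    isMinimalSurfaceOn_bourSurface3,
    bourEquation, isImplicitEquation_bourEquation, totalDegree_bourEquation⟩
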